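/- Let $K\subset\mathbb R^n$ be a convex body (a compact convex set with nonempty interior), and let $F:K\to\mathbb R$ be of class $C^1$ on $K$ (up to the boundary), with differential $dF(x)$ at $x\in K$. Let $\|\cdot\|$ be the norm on $\mathbb R^n$ with unit ball $K+(-K)=\{a-b: a,b\in K\}$, and let $\|\varphi\|_*=\sup\{|\varphi(v)| : \|v\|\le 1\}$ be the dual norm on linear functionals $\varphi:\mathbb R^n\to\mathbb R$. Then $$\max_{x\in K}F(x)-\min_{x\in K}F(x)\ \ge\ \min_{x\in K}\|dF(x)\|_* ,$$ where all the maxima and minima are attained. Moreover, for every linear functional $\varphi$ the dual norm is the width of $K$ in the direction of $\varphi$, that is, $\|\varphi\|_*=w_K(\varphi):=\max_{K}\varphi-\min_{K}\varphi$; hence, equivalently, $$\max_{x\in K}F(x)-\min_{x\in K}F(x)\ \ge\ \min_{x\in K}w_K(dF(x)) ,$$ where the minimum on the right is again attained. -/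

import Mathlib

open scoped Pointwise

/-- The norm on `ℝⁿ` with unit ball `K + (-K)`, that is, the Minkowski functional of `K - K`. -/
noncomputable def diffNorm {n : ℕ} (K : ConvexBody (EuclideanSpace ℝ (Fin n)))
    (v : EuclideanSpace ℝ (Fin n)) : ℝ :=
  gauge ((K : Set (EuclideanSpace ℝ (Fin n))) + -(K : Set (EuclideanSpace ℝ (Fin n)))) v

/-- The dual norm of `diffNorm K` on linear functionals: `‖φ‖_* = sup {|φ v| : ‖v‖ ≤ 1}`. -/
noncomputable def dualDiffNorm {n : ℕ} (K : ConvexBody (EuclideanSpace ℝ (Fin n)))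
    (φ : EuclideanSpace ℝ (Fin n) →L[ℝ] ℝ) : ℝ :=
  sSup ((fun v => |φ v|) '' {v | diffNorm K v ≤ 1})

/-- The width of `K` in the direction of the linear functional `φ`: `max_K φ - min_K φ`. -/
noncomputable def widthInDirection {n : ℕ} (K : ConvexBody (EuclideanSpace ℝ (Fin n)))
    (φ : EuclideanSpace ℝ (Fin n) →L[ℝ] ℝ) : ℝ :=
  sSup (φ '' (K : Set (EuclideanSpace ℝ (Fin n)))) -
    sInf (φ '' (K : Set (EuclideanSpace ℝ (Fin n))))

/-!
Let `d` be the minimal width of `K` in the directions `dF(x)`. The inequality follows from the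
existence of a curve in `K` along which `F` increases by at least `d`. Suppose `a(s)` maximizes and
`b(s)` minimizes `dF(γ(s))` over `K`, where
`γ(t) = ∫_0^t a(s) ds + ∫_t^1 b(s) ds`.
Each `γ(t)` is an average of points of `K`, so it lies in `K`; and `γ' = a - b`, so the derivative
of `F ∘ γ` is the width of `K` in the direction `dF(γ)`, which is at least `d`.

The equation for `γ` is implicit, and it is solved approximately. The extremal points are replaced
by almost extremal ones that depend continuously on the functional
(`exists_continuous_almost_maximizer`, a metric projection onto `K`), and the integrals by averages
of `N` points. The initial point must then be a fixed point of the continuous map sending `x` to the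
average of the points `b` met along the orbit started at `x` (`exists_discrete_curve`). Uniform
continuity of `dF` on `K` bounds the discretization error
(`exists_sub_ge_of_forall_exists_sub_ge`), and the total error is arbitrarily small.

The fixed point comes from Brouwer's theorem
(`exists_fixedPoint_of_continuous_of_mem_isCompact`), proved by the analytic argument of Milnor and
Rogers. If `r` were a `C¹` map sending the ball `B` to its boundary sphere and fixing the sphere
pointwise, then for small `t > 0` the map `x ↦ x + t (r x - x)` would be a bijection of `B`, so its
Jacobian determinant would integrate to `vol B`. This integral is polynomial in `t`, so it would be
`vol B` at `t = 1` as well, where the determinant of `dr` vanishes identically.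

The identification of the dual norm with the width holds because the closed unit ball of `diffNorm K`
is exactly `K - K`, which is compact and is a neighbourhood of `0`.
-/

/-! ### Metric projection onto a compact convex set -/

/-- The nearest-point map onto a compact convex set: it is `1`-Lipschitz, and it is characterized by
its variational inequality. -/
theorem exists_metricProjection {E : Type*} [NormedAddCommGroup E] [InnerProductSpace ℝ E]
    {K : Set E} (hc : IsCompact K) (hconv : Convex ℝ K) (hne : K.Nonempty) :
    ∃ P : E → E, LipschitzWith 1 P ∧ (∀ x, P x ∈ K) ∧
      ∀ x, ∀ w ∈ K, inner ℝ (x - P x) (w - P x) ≤ 0 := by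
  choose P hPK hP using exists_norm_eq_iInf_of_complete_convex hne hc.isComplete hconv
  have hvar : ∀ x, ∀ w ∈ K, inner ℝ (x - P x) (w - P x) ≤ 0 := fun x =>
    (norm_eq_iInf_iff_real_inner_le_zero hconv (hPK x)).1 (hP x)
  refine ⟨P, LipschitzWith.of_dist_le_mul fun x y => ?_, hPK, hvar⟩
  have h1 := hvar x (P y) (hPK y)
  have h2 := hvar y (P x) (hPK x)
  have h3 : inner ℝ (P x - P y) (P x - P y) ≤ inner ℝ (x - y) (P x - P y) := by
    simp only [inner_sub_left, inner_sub_right] at *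
    linarith
  have h4 := real_inner_le_norm (x - y) (P x - P y)
  rw [real_inner_self_eq_norm_sq] at h3
  rw [dist_eq_norm, dist_eq_norm, NNReal.coe_one, one_mul]
  by_contra hlt
  push Not at hlt
  nlinarith [norm_nonneg (x - y), norm_nonneg (P x - P y)]

theorem eq_self_of_inner_sub_le_zero {E : Type*} [NormedAddCommGroup E] [InnerProductSpace ℝ E]
    {x p : E} (h : inner ℝ (x - p) (x - p) ≤ 0) : p = x := by
  rw [real_inner_self_nonpos, sub_eq_zero] at h
  exact h.symm

/-! ### Determinants of perturbations of the identity -/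

/-- Lagrange interpolation at small nodes: `det (1 + s M)` is a polynomial in `s` of degree at most
`finrank ℝ E`, so its value at `s = 1` is a combination of its values at `finrank ℝ E + 1` points
of `(0, t₀]`, with coefficients independent of `M` and of sum `1`. -/
theorem exists_det_one_add_eq_sum (E : Type*) [NormedAddCommGroup E] [NormedSpace ℝ E]
    [FiniteDimensional ℝ E] {t₀ : ℝ} (ht₀ : 0 < t₀) :
    ∃ (m : ℕ) (t c : Fin m → ℝ), (∀ i, 0 < t i ∧ t i ≤ t₀) ∧ ∑ i, c i = 1 ∧
      ∀ M : E →L[ℝ] E, (1 + M).det = ∑ i, c i * (1 + t i • M).det := by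
  classical
  set n := Module.finrank ℝ E
  let b := Module.finBasis ℝ E
  -- Any distinct nodes in `(0, t₀]` would do.
  let v : Fin (n + 1) → ℝ := fun i => t₀ / (i + 1)
  have hv : Set.InjOn v ↑(Finset.univ : Finset (Fin (n + 1))) := by
    intro i _ j _ hij
    have hi : (i : ℝ) + 1 ≠ 0 := by positivity
    have hj : (j : ℝ) + 1 ≠ 0 := by positivity
    simp only [v] at hij
    field_simp at hij
    exact Fin.ext (by exact_mod_cast (add_right_cancel hij).symm)
  refine ⟨n + 1, v, fun i => (Lagrange.basis Finset.univ v i).eval 1, fun i => ⟨by positivity, ?_⟩,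
    ?_, fun M => ?_⟩
  · exact div_le_self ht₀.le (by simp)
  · rw [← Polynomial.eval_finsetSum, Lagrange.sum_basis hv Finset.univ_nonempty,
      Polynomial.eval_one]
  · let A := LinearMap.toMatrix b b (M : E →ₗ[ℝ] E)
    let p : Polynomial ℝ :=
      Matrix.det ((Polynomial.X : Polynomial ℝ) • A.map Polynomial.C
        + (1 : Matrix (Fin n) (Fin n) ℝ).map Polynomial.C)
    have hp : ∀ s : ℝ, p.eval s = (1 + s • M).det := by
      intro s
      have hmat : LinearMap.toMatrix b b ((1 + s • M : E →L[ℝ] E) : E →ₗ[ℝ] E) = s • A + 1 := by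
        have : ((1 + s • M : E →L[ℝ] E) : E →ₗ[ℝ] E) = s • (M : E →ₗ[ℝ] E) + LinearMap.id := by
          ext x
          simp [add_comm]
        rw [this, map_add, map_smul, LinearMap.toMatrix_id]
      rw [ContinuousLinearMap.det, ← LinearMap.det_toMatrix b, hmat]
      simp only [p]
      rw [← Polynomial.coe_evalRingHom, RingHom.map_det]
      congr 1
      ext i j
      rcases eq_or_ne i j with rfl | hij
      · simp [mul_comm s]
      · simp [Matrix.one_apply_ne hij, mul_comm s]
    have hdeg : p.degree < (Finset.univ : Finset (Fin (n + 1))).card := by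
      refine lt_of_le_of_lt Polynomial.degree_le_natDegree ?_
      have := Polynomial.natDegree_det_X_add_C_le A (1 : Matrix (Fin n) (Fin n) ℝ)
      rw [Finset.card_univ, Fintype.card_fin]
      rw [Fintype.card_fin] at this
      exact_mod_cast Nat.lt_succ_of_le this
    have h1 := hp 1
    rw [one_smul] at h1
    rw [← h1, Lagrange.eq_interpolate hv hdeg, Lagrange.interpolate_apply,
      Polynomial.eval_finsetSum]
    refine Finset.sum_congr rfl fun i _ => ?_
    rw [Polynomial.eval_mul, Polynomial.eval_C, hp, mul_comm]

theorem det_one_add_ne_zero {E : Type*} [NormedAddCommGroup E] [NormedSpace ℝ E]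
    {M : E →L[ℝ] E} (hM : ‖M‖ < 1) : (1 + M).det ≠ 0 := by
  intro h0
  obtain ⟨v, hv, hv0⟩ := (Submodule.ne_bot_iff _).1
    (LinearMap.bot_lt_ker_of_det_eq_zero h0).ne'
  have hv' : v + M v = 0 := by simpa using hv
  have h1 : ‖v‖ ≤ ‖M‖ * ‖v‖ := by
    calc ‖v‖ = ‖M v‖ := (congrArg norm (eq_neg_of_add_eq_zero_left hv')).trans (norm_neg _)
      _ ≤ _ := M.le_opNorm v
  have := norm_pos_iff.2 hv0
  nlinarith

/-- The determinant does not vanish on the segment from `1` to `1 + M`, hence keeps its sign. -/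
theorem det_one_add_pos {E : Type*} [NormedAddCommGroup E] [NormedSpace ℝ E]
    [FiniteDimensional ℝ E] {M : E →L[ℝ] E} (hM : ‖M‖ < 1) : 0 < (1 + M).det := by
  have hcont : Continuous fun s : ℝ => (1 + s • M).det :=
    ContinuousLinearMap.continuous_det.comp (by fun_prop)
  by_contra hneg
  push Not at hneg
  obtain ⟨s, hs, hs0⟩ := intermediate_value_Icc' (zero_le_one' ℝ) hcont.continuousOn
    (show (0 : ℝ) ∈ Set.Icc _ _ by
      constructor
      · simpa using hneg
      · simp [ContinuousLinearMap.det])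
  refine det_one_add_ne_zero ?_ hs0
  rw [norm_smul, Real.norm_of_nonneg hs.1]
  nlinarith [norm_nonneg M, hs.2]

/-! ### Brouwer's fixed point theorem -/

/-- If `r` takes values in a sphere, then `r x` is orthogonal to the range of the derivative at `x`. -/
theorem det_fderiv_eq_zero_of_norm_eq {E : Type*} [NormedAddCommGroup E] [InnerProductSpace ℝ E]
    [FiniteDimensional ℝ E] {r : E → E} {S : ℝ} (hS : 0 < S) (hr : Differentiable ℝ r)
    (hnorm : ∀ x, ‖r x‖ = S) (x : E) : (fderiv ℝ r x).det = 0 := by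
  by_contra hdet
  have hsurj := (LinearMap.equivOfDetNeZero (fderiv ℝ r x : E →ₗ[ℝ] E) hdet).surjective
  obtain ⟨v, hv⟩ := hsurj (r x)
  replace hv : fderiv ℝ r x v = r x := hv
  have hconst : (fun y => inner ℝ (r y) (r y)) = fun _ => S ^ 2 := by
    funext y
    rw [real_inner_self_eq_norm_sq, hnorm]
  have h1 := fderiv_inner_apply (𝕜 := ℝ) (hr x) (hr x) v
  rw [hconst, hv, real_inner_self_eq_norm_sq, hnorm] at h1
  simp at h1
  nlinarith

/-- A small step from the identity towards a self-map of a ball that fixes the boundary sphere is a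
bijection of the ball. -/
theorem bijOn_closedBall_add_smul {E : Type*} [NormedAddCommGroup E] [InnerProductSpace ℝ E]
    [FiniteDimensional ℝ E] {r : E → E} {S : ℝ} {L : NNReal} (hS : 0 < S)
    (hid : ∀ x, ‖x‖ = S → r x = x)
    (hmaps : Set.MapsTo r (Metric.closedBall 0 S) (Metric.closedBall 0 S))
    (hL : LipschitzOnWith L (fun x => r x - x) (Metric.closedBall 0 S)) {t : ℝ} (ht : 0 ≤ t)
    (ht1 : t ≤ 1) (htL : t * L < 1) :
    Set.BijOn (fun x => x + t • (r x - x)) (Metric.closedBall 0 S) (Metric.closedBall 0 S) := by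
  have : Nonempty E := ⟨0⟩
  obtain ⟨P, hP1, hPB, hP⟩ := exists_metricProjection (isCompact_closedBall (0 : E) S)
    (convex_closedBall 0 S) ⟨0, by simp [hS.le]⟩
  have hPid : ∀ x ∈ Metric.closedBall (0 : E) S, P x = x := fun x hx =>
    eq_self_of_inner_sub_le_zero (hP x x hx)
  refine ⟨fun x hx => ?_, fun x hx y hy hxy => ?_, fun y hy => ?_⟩
  · have := convex_closedBall (0 : E) S hx (hmaps hx) (sub_nonneg.2 ht1) ht (by ring)
    convert this using 1
    module
  · have h1 : x - y = t • ((r y - y) - (r x - x)) := by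
      rw [smul_sub, sub_eq_sub_iff_add_eq_add]
      simpa [add_comm] using hxy
    have h2 := hL.dist_le_mul y hy x hx
    rw [dist_eq_norm, dist_eq_norm, norm_sub_rev y x] at h2
    have h3 : ‖x - y‖ = t * ‖(r y - y) - (r x - x)‖ := by
      conv_lhs => rw [h1]
      rw [norm_smul, Real.norm_of_nonneg ht]
    have h4 : ‖x - y‖ ≤ t * L * ‖x - y‖ := by
      rw [mul_assoc]
      exact h3.le.trans (mul_le_mul_of_nonneg_left h2 ht)
    rw [← sub_eq_zero, ← norm_le_zero_iff]
    nlinarith [norm_nonneg (x - y)]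
  · -- Extending `r x - x` by its value at the projection, which vanishes outside the ball,
    -- turns surjectivity into a fixed point problem for a contraction of the whole space.
    let w : E → E := fun x => r (P x) - P x
    have hw : LipschitzWith L w := by
      have := hL.comp hP1.lipschitzOnWith (fun x _ => hPB x) (s := Set.univ)
      simpa [lipschitzOnWith_univ, Function.comp_def, w] using this
    have hcontr : ContractingWith (t.toNNReal * L) fun x => y - t • w x := by
      refine ⟨?_, LipschitzWith.of_dist_le_mul fun a b => ?_⟩
      · rw [← NNReal.coe_lt_coe]
        simpa [Real.coe_toNNReal _ ht] using htL
      · rw [dist_eq_norm, sub_sub_sub_cancel_left, ← smul_sub, norm_smul, Real.norm_of_nonneg ht,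
          norm_sub_rev, ← dist_eq_norm, NNReal.coe_mul, Real.coe_toNNReal _ ht, mul_assoc]
        exact mul_le_mul_of_nonneg_left (hw.dist_le_mul a b) ht
    have hx : hcontr.fixedPoint = y - t • w hcontr.fixedPoint := hcontr.fixedPoint_isFixedPt.symm
    set x := hcontr.fixedPoint
    have hxB : x ∈ Metric.closedBall (0 : E) S := by
      by_contra hxB
      have hPx : ‖P x‖ = S := by
        refine le_antisymm (mem_closedBall_zero_iff.1 (hPB x)) ?_
        -- If `P x` were interior to the ball, moving it slightly towards `x` would stay in the ball.
        by_contra! hlt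
        have hpos : 0 < ‖x - P x‖ := norm_pos_iff.2 fun h =>
          hxB (by rw [sub_eq_zero.1 h]; exact hPB x)
        have hz := hP x (P x + ((S - ‖P x‖) / ‖x - P x‖) • (x - P x)) (by
          rw [mem_closedBall_zero_iff]
          refine (norm_add_le _ _).trans ?_
          rw [norm_smul, norm_div, norm_norm, Real.norm_of_nonneg (by linarith),
            div_mul_cancel₀ _ hpos.ne']
          linarith)
        rw [add_sub_cancel_left, inner_smul_right, real_inner_self_eq_norm_sq] at hz
        have : 0 < (S - ‖P x‖) / ‖x - P x‖ * ‖x - P x‖ ^ 2 :=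
          mul_pos (div_pos (by linarith) hpos) (pow_pos hpos 2)
        linarith
      have hw0 : w x = 0 := by simp [w, hid _ hPx]
      rw [hw0, smul_zero, sub_zero] at hx
      exact hxB (hx ▸ hy)
    refine ⟨x, hxB, ?_⟩
    simp only [w, hPid x hxB] at hx
    exact eq_sub_iff_add_eq.1 hx

open MeasureTheory in
/-- With `B` the ball of radius `S`, the integral over `B` of `det (1 + t (Dr - 1))` is `vol B` at all
interpolation nodes `t`, hence also at `t = 1`, where the integrand is zero. -/
theorem not_exists_contDiff_retraction_sphere {E : Type*} [NormedAddCommGroup E]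
    [InnerProductSpace ℝ E] [FiniteDimensional ℝ E] {r : E → E} {S : ℝ} (hS : 0 < S)
    (hr : ContDiff ℝ 1 r) (hid : ∀ x, ‖x‖ = S → r x = x) (hnorm : ∀ x, ‖r x‖ = S) : False := by
  borelize E
  set B := Metric.closedBall (0 : E) S with hB
  have hBc : IsCompact B := isCompact_closedBall 0 S
  have hdiff : Differentiable ℝ r := hr.differentiable one_ne_zero
  let u' : E → E →L[ℝ] E := fun x => fderiv ℝ r x - 1
  have hu' : ∀ x, HasFDerivAt (fun x => r x - x) (u' x) x := fun x =>
    (hdiff x).hasFDerivAt.sub (hasFDerivAt_id x)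
  have hu'c : Continuous u' := (hr.continuous_fderiv one_ne_zero).sub continuous_const
  obtain ⟨C, hC⟩ := hBc.exists_bound_of_continuousOn hu'c.continuousOn
  -- Adding `1` makes `L ≥ 1`, so that nodes below `1 / (2 L)` are also at most `1`.
  let L : NNReal := C.toNNReal + 1
  have hCL : ∀ x ∈ B, ‖u' x‖ ≤ L := fun x hx =>
    (hC x hx).trans ((Real.le_coe_toNNReal C).trans (by simp [L]))
  have hL : LipschitzOnWith L (fun x => r x - x) B :=
    (convex_closedBall 0 S).lipschitzOnWith_of_nnnorm_hasFDerivWithin_le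
      (fun x _ => (hu' x).hasFDerivWithinAt) hCL
  have hmaps : Set.MapsTo r B B := fun x _ => by simp [B, hnorm]
  have hL1 : (1 : ℝ) ≤ L := by simp [L]
  obtain ⟨m, t, c, ht, hc, hdet⟩ := exists_det_one_add_eq_sum E (t₀ := 1 / (2 * L)) (by positivity)
  have htL : ∀ i, t i * L < 1 := fun i => by
    have := mul_le_mul_of_nonneg_right (ht i).2 L.coe_nonneg
    have h2 : 1 / (2 * (L : ℝ)) * L = 1 / 2 := by field_simp
    linarith
  have hvol : ∀ i, ∫ x in B, (1 + t i • u' x).det = volume.real B := by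
    intro i
    have ht1 : t i ≤ 1 := by nlinarith [htL i, (ht i).1]
    have hbij := bijOn_closedBall_add_smul hS hid hmaps hL (ht i).1.le ht1 (htL i)
    have hderiv : ∀ x ∈ B, HasFDerivWithinAt (fun x => x + t i • (r x - x)) (1 + t i • u' x) B x :=
      fun x _ => ((hasFDerivAt_id x).add ((hu' x).const_smul (t i))).hasFDerivWithinAt
    have h := integral_image_eq_integral_abs_det_fderiv_smul volume
      Metric.isClosed_closedBall.measurableSet hderiv hbij.injOn (fun _ => (1 : ℝ))
    rw [hbij.image_eq] at h
    simp only [integral_const, smul_eq_mul, mul_one, MeasurableSet.univ, measureReal_restrict_apply,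
      Set.univ_inter] at h
    rw [h]
    refine setIntegral_congr_fun Metric.isClosed_closedBall.measurableSet fun x hx => ?_
    refine (abs_of_pos (det_one_add_pos ?_)).symm
    rw [norm_smul, Real.norm_of_nonneg (ht i).1.le]
    exact (mul_le_mul_of_nonneg_left (hCL x hx) (ht i).1.le).trans_lt (htL i)
  have hint : ∀ i, IntegrableOn (fun x => (1 + t i • u' x).det) B := fun i =>
    (ContinuousLinearMap.continuous_det.comp (by fun_prop)).continuousOn.integrableOn_compact hBc
  have hzero : ∫ x in B, (1 + u' x).det = 0 := by
    have : ∀ x, (1 + u' x).det = 0 := fun x => by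
      simp only [u', add_sub_cancel]
      exact det_fderiv_eq_zero_of_norm_eq hS hdiff hnorm x
    simp [this]
  rw [funext fun x => hdet (u' x)] at hzero
  rw [integral_finsetSum _ fun i _ => (hint i).const_mul (c i)] at hzero
  simp_rw [integral_const_mul, hvol, ← Finset.sum_mul, hc, one_mul] at hzero
  have hpos : 0 < volume.real B := ENNReal.toReal_pos
    (Metric.measure_closedBall_pos volume 0 hS).ne' hBc.measure_ne_top
  exact hpos.ne' hzero

/-- **Brouwer's fixed point theorem**, for continuous self-maps of the whole space with relatively
compact range. A `C¹` approximation `g` of `f`, cut off by a bump function `χ`, would give a map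
`h x = x - χ x • g x` without zeros that is the identity on a large sphere; normalizing `h` would
then give a retraction of the ball onto that sphere. -/
theorem exists_fixedPoint_of_continuous_of_mem_isCompact {E : Type*} [NormedAddCommGroup E]
    [InnerProductSpace ℝ E] [FiniteDimensional ℝ E] {f : E → E} (hf : Continuous f) {K : Set E}
    (hK : IsCompact K) (hfK : ∀ x, f x ∈ K) : ∃ x, f x = x := by
  by_contra! hfix
  obtain ⟨R, hR, hKR⟩ := hK.isBounded.exists_pos_norm_le
  have hne : (Metric.closedBall (0 : E) (R + 1)).Nonempty := ⟨0, by simp; linarith⟩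
  obtain ⟨x₀, -, hx₀⟩ := (isCompact_closedBall (0 : E) (R + 1)).exists_isMinOn hne
    (f := fun x => ‖f x - x‖) (by fun_prop)
  set ε := min 1 ‖f x₀ - x₀‖ with hε
  have hεpos : 0 < ε := lt_min one_pos (norm_pos_iff.2 (sub_ne_zero.2 (hfix x₀)))
  obtain ⟨g, hg, hgf, -⟩ := hf.exists_contDiff_approx 1 (continuous_const (y := ε)) fun _ => hεpos
  have hgR : ∀ x, ‖g x‖ ≤ R + 1 := fun x => by
    have h1 := hgf x
    rw [dist_eq_norm] at h1
    calc ‖g x‖ = ‖(g x - f x) + f x‖ := by rw [sub_add_cancel]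
      _ ≤ ‖g x - f x‖ + ‖f x‖ := norm_add_le _ _
      _ ≤ R + 1 := by linarith [hKR _ (hfK x), min_le_left 1 ‖f x₀ - x₀‖]
  -- `χ` is `1` on the ball of radius `R + 1`, which contains the range of `g`, and vanishes from
  -- radius `R + 2` on.
  let χ : ContDiffBump (0 : E) := ⟨R + 1, R + 2, by linarith, by linarith⟩
  let h : E → E := fun x => x - χ x • g x
  have hh0 : ∀ x, h x ≠ 0 := by
    intro x hx
    have hxe : x = χ x • g x := sub_eq_zero.1 hx
    have hxR : ‖x‖ ≤ R + 1 := by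
      rw [hxe, norm_smul, Real.norm_of_nonneg χ.nonneg]
      nlinarith [hgR x, norm_nonneg (g x), χ.le_one (x := x), χ.nonneg (x := x)]
    have hxB : x ∈ Metric.closedBall (0 : E) (R + 1) := mem_closedBall_zero_iff.2 hxR
    rw [χ.one_of_mem_closedBall hxB, one_smul] at hxe
    have h1 := hgf x
    rw [← hxe, dist_comm, dist_eq_norm] at h1
    exact absurd ((hx₀ hxB).trans_lt (h1.trans_le (min_le_right _ _))) (lt_irrefl _)
  have hh : ContDiff ℝ 1 h := contDiff_id.sub (χ.contDiff.smul hg)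
  refine not_exists_contDiff_retraction_sphere (S := R + 2) (by linarith)
    (r := fun x => ((R + 2) / ‖h x‖) • h x)
    ((contDiff_const.div (hh.norm ℝ hh0) fun x => norm_ne_zero_iff.2 (hh0 x)).smul hh)
    (fun x hx => ?_) fun x => ?_
  · have hχ : χ x = 0 := χ.zero_of_le_dist (by rw [dist_zero_right, hx])
    have hhx : h x = x := by simp [h, hχ]
    simp only [hhx, hx]
    rw [div_self (by linarith), one_smul]
  · rw [norm_smul, norm_div, norm_norm, Real.norm_of_nonneg (by linarith),
      div_mul_cancel₀ _ (norm_ne_zero_iff.2 (hh0 x))]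

/-! ### Curves driven by almost extremal points -/

/-- A discrete form of the equation `γ(t) = ∫_0^t A(γ(s)) ds + ∫_t^1 B(γ(s)) ds`: there is an orbit of
the Euler scheme with velocity `A - B` and step `1 / N` whose first `N + 1` points lie in `K`. -/
theorem exists_discrete_curve {E : Type*} [NormedAddCommGroup E]
    [InnerProductSpace ℝ E] [FiniteDimensional ℝ E] {K : Set E} (hK : IsCompact K)
    (hconv : Convex ℝ K) {A B : E → E} (hA : Continuous A) (hB : Continuous B)
    (hAK : ∀ x, A x ∈ K) (hBK : ∀ x, B x ∈ K) {N : ℕ} (hN : 0 < N) :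
    ∃ γ : ℕ → E, (∀ j ≤ N, γ j ∈ K) ∧
      ∀ j, γ (j + 1) = γ j + (N : ℝ)⁻¹ • (A (γ j) - B (γ j)) := by
  have hN' : (0 : ℝ) < N := Nat.cast_pos.2 hN
  have havg : ∀ c : ℕ → E, (∀ i, c i ∈ K) → (N : ℝ)⁻¹ • ∑ i ∈ Finset.range N, c i ∈ K := by
    intro c hc
    rw [Finset.smul_sum]
    refine hconv.sum_mem (fun _ _ => by positivity) ?_ fun i _ => hc i
    rw [Finset.sum_const, Finset.card_range, nsmul_eq_mul, mul_inv_cancel₀ hN'.ne']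
  let T : E → E := fun x => x + (N : ℝ)⁻¹ • (A x - B x)
  have hT : Continuous T := by fun_prop
  -- The initial point has to be the average of the points `B` along its own orbit.
  obtain ⟨x₀, hx₀⟩ := exists_fixedPoint_of_continuous_of_mem_isCompact
    (f := fun x => (N : ℝ)⁻¹ • ∑ i ∈ Finset.range N, B (T^[i] x))
    (by
      refine continuous_const.smul (continuous_finsetSum _ fun i _ => ?_)
      exact hB.comp (hT.iterate i)) hK fun x => havg _ fun i => hBK _
  have hstep : ∀ j, T^[j + 1] x₀ = T^[j] x₀ + (N : ℝ)⁻¹ • (A (T^[j] x₀) - B (T^[j] x₀)) :=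
    fun j => Function.iterate_succ_apply' T j x₀
  -- Each step replaces one `B` by the corresponding `A` in the average that gives the current point.
  have hsum : ∀ j ≤ N, T^[j] x₀ = (N : ℝ)⁻¹ • ∑ i ∈ Finset.range N,
      if i < j then A (T^[i] x₀) else B (T^[i] x₀) := by
    intro j
    induction j with
    | zero => intro _; simpa using hx₀.symm
    | succ j ih =>
      intro hj
      rw [hstep]
      nth_rewrite 1 [ih (by omega)]
      rw [← smul_add]
      congr 1
      rw [eq_comm, ← sub_eq_iff_eq_add', ← Finset.sum_sub_distrib,
        Finset.sum_eq_single_of_mem j (Finset.mem_range.2 hj)]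
      · simp
      · intro i _ hij
        have : i < j + 1 ↔ i < j := by omega
        simp [this]
  refine ⟨fun j => T^[j] x₀, fun j hj => ?_, hstep⟩
  simp only [hsum j hj]
  exact havg _ fun i => by split_ifs <;> [exact hAK _; exact hBK _]

/-- Maximizers of linear functionals on `K` need not depend continuously on the functional, but
`ε`-maximizers can be chosen to: project a large multiple of the Riesz representative of `φ`
onto `K`. -/
theorem exists_continuous_almost_maximizer {E : Type*} [NormedAddCommGroup E]
    [InnerProductSpace ℝ E] [FiniteDimensional ℝ E] {K : Set E} (hK : IsCompact K)
    (hconv : Convex ℝ K) (hne : K.Nonempty) {ε : ℝ} (hε : 0 < ε) :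
    ∃ A : (E →L[ℝ] ℝ) → E, Continuous A ∧ (∀ φ, A φ ∈ K) ∧
      ∀ φ : E →L[ℝ] ℝ, ∀ w ∈ K, φ w - ε ≤ φ (A φ) := by
  obtain ⟨P, hP1, hPK, hP⟩ := exists_metricProjection hK hconv hne
  obtain ⟨R, hR, hKR⟩ := hK.isBounded.exists_pos_norm_le
  -- The projection `p` of `s • φ` satisfies `s (φ w - φ p) ≤ ⟪p, w - p⟫ ≤ 2 R ^ 2` for all `w ∈ K`.
  let s : ℝ := 2 * R ^ 2 / ε
  have hs : 0 < s := by positivity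
  refine ⟨fun φ => P (s • (InnerProductSpace.toDual ℝ E).symm φ),
    hP1.continuous.comp (by fun_prop), fun φ => hPK _, fun φ w hw => ?_⟩
  have h := hP (s • (InnerProductSpace.toDual ℝ E).symm φ) w hw
  set p := P (s • (InnerProductSpace.toDual ℝ E).symm φ) with hp
  rw [inner_sub_left, real_inner_smul_left, InnerProductSpace.toDual_symm_apply, map_sub] at h
  have h1 : inner ℝ p (w - p) ≤ R * (2 * R) := by
    refine (real_inner_le_norm _ _).trans (mul_le_mul (hKR p (hPK _)) ?_ (norm_nonneg _) hR.le)
    linarith [norm_sub_le w p, hKR w hw, hKR p (hPK _)]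
  have h2 : s * (φ w - φ p) ≤ s * ε := by
    have : s * ε = R * (2 * R) := by simp only [s]; field_simp
    linarith
  linarith [le_of_mul_le_mul_left h2 hs]

/-- If every differential `F' x` has oscillation at least `d` on `K`, then so does `F`, up to an
arbitrarily small error. -/
theorem exists_sub_ge_of_forall_exists_sub_ge {E : Type*} [NormedAddCommGroup E]
    [InnerProductSpace ℝ E] [FiniteDimensional ℝ E] {K : Set E} (hK : IsCompact K)
    (hconv : Convex ℝ K) (hne : K.Nonempty) {F : E → ℝ} {F' : E → E →L[ℝ] ℝ}
    (hF : ∀ x ∈ K, HasFDerivWithinAt F (F' x) K x) (hF' : ContinuousOn F' K) {d : ℝ}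
    (hd : ∀ x ∈ K, ∃ a ∈ K, ∃ b ∈ K, d ≤ F' x a - F' x b) {η : ℝ} (hη : 0 < η) :
    ∃ x ∈ K, ∃ y ∈ K, d - η ≤ F y - F x := by
  obtain ⟨P, hP1, hPK, hP⟩ := exists_metricProjection hK hconv hne
  have hPid : ∀ x ∈ K, P x = x := fun x hx => eq_self_of_inner_sub_le_zero (hP x x hx)
  obtain ⟨R, hR, hKR⟩ := hK.isBounded.exists_pos_norm_le
  have hη3 : 0 < η / 3 := by positivity
  obtain ⟨M, hMc, hMK, hM⟩ := exists_continuous_almost_maximizer hK hconv hne hη3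
  have hG : Continuous fun x => F' (P x) := hF'.comp_continuous hP1.continuous hPK
  -- Of the total error `η`, two thirds come from the almost extremal points and one third from the
  -- variation of `F'` along a step, whose length is at most `2 R / n`.
  obtain ⟨δ, hδ, hunif⟩ := Metric.uniformContinuousOn_iff.1
    (hK.uniformContinuousOn_of_continuous hF') (η / (6 * R)) (by positivity)
  obtain ⟨n, hn⟩ := exists_nat_gt (2 * R / δ)
  have hNpos : (0 : ℝ) < n := lt_trans (by positivity) hn
  obtain ⟨γ, hγK, hγ⟩ := exists_discrete_curve hK hconv (A := fun x => M (F' (P x)))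
    (B := fun x => M (-F' (P x))) (hMc.comp hG) (hMc.comp hG.neg) (fun _ => hMK _) (fun _ => hMK _)
    (Nat.cast_pos.1 hNpos)
  have hstep : ∀ j < n, (n : ℝ)⁻¹ * (d - η) ≤ F (γ (j + 1)) - F (γ j) := by
    intro j hj
    have hjK := hγK j hj.le
    have hγj := hγ j
    rw [hPid _ hjK] at hγj
    set φ := F' (γ j)
    set v := M φ - M (-φ)
    have hv : ‖v‖ ≤ 2 * R := by
      linarith [norm_sub_le (M φ) (M (-φ)), hKR _ (hMK φ), hKR _ (hMK (-φ))]
    have hdiff : γ (j + 1) - γ j = (n : ℝ)⁻¹ • v := by rw [hγj, add_sub_cancel_left]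
    have hnorm : ‖γ (j + 1) - γ j‖ ≤ (n : ℝ)⁻¹ * (2 * R) := by
      rw [hdiff, norm_smul, Real.norm_of_nonneg (by positivity)]
      exact mul_le_mul_of_nonneg_left hv (by positivity)
    have hsmall : (n : ℝ)⁻¹ * (2 * R) < δ := by
      rw [div_lt_iff₀ hδ] at hn
      rwa [inv_mul_lt_iff₀ hNpos]
    have hball : γ (j + 1) ∈ Metric.ball (γ j) δ := by
      rw [mem_ball_iff_norm]
      exact hnorm.trans_lt hsmall
    have hmv := (hconv.inter (convex_ball (γ j) δ)).norm_image_sub_le_of_norm_hasFDerivWithin_le'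
      (f := F) (f' := F') (φ := φ) (C := η / (6 * R)) (x := γ j) (y := γ (j + 1))
      (fun x hx => (hF x hx.1).mono Set.inter_subset_left)
      (fun x hx => by
        rw [← dist_eq_norm]
        exact (hunif x hx.1 (γ j) hjK hx.2).le)
      ⟨hjK, Metric.mem_ball_self hδ⟩ ⟨hγK (j + 1) hj, hball⟩
    have hφv : d - 2 * (η / 3) ≤ φ v := by
      obtain ⟨a, ha, b, hb, hab⟩ := hd _ hjK
      have h1 := hM φ a ha
      have h2 := hM (-φ) b hb
      simp only [neg_apply] at h2
      rw [map_sub]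
      linarith
    have herr : η / (6 * R) * ‖γ (j + 1) - γ j‖ ≤ (n : ℝ)⁻¹ * (η / 3) := by
      refine (mul_le_mul_of_nonneg_left hnorm (by positivity)).trans_eq ?_
      field_simp
      norm_num
    rw [hdiff, map_smul, smul_eq_mul, ← hdiff, Real.norm_eq_abs] at hmv
    have h3 := (abs_le.1 hmv).1
    have h4 := mul_le_mul_of_nonneg_left hφv (inv_nonneg.2 hNpos.le)
    have h5 : (n : ℝ)⁻¹ * (d - 2 * (η / 3)) - (n : ℝ)⁻¹ * (η / 3) = (n : ℝ)⁻¹ * (d - η) := by ring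
    linarith
  refine ⟨γ 0, hγK 0 (Nat.zero_le _), γ n, hγK n le_rfl, ?_⟩
  calc d - η = ∑ _j ∈ Finset.range n, (n : ℝ)⁻¹ * (d - η) := by
        rw [Finset.sum_const, Finset.card_range, nsmul_eq_mul, mul_inv_cancel_left₀ hNpos.ne']
    _ ≤ ∑ j ∈ Finset.range n, (F (γ (j + 1)) - F (γ j)) :=
        Finset.sum_le_sum fun j hj => hstep j (Finset.mem_range.1 hj)
    _ = F (γ n) - F (γ 0) := Finset.sum_range_sub (fun j => F (γ j)) n

/-! ### Width and dual norm -/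

theorem diffNorm_le_one_iff {n : ℕ} (K : ConvexBody (EuclideanSpace ℝ (Fin n)))
    (hK : (interior (K : Set (EuclideanSpace ℝ (Fin n)))).Nonempty)
    (v : EuclideanSpace ℝ (Fin n)) : diffNorm K v ≤ 1 ↔ ∃ a ∈ K, ∃ b ∈ K, a - b = v := by
  have hcomp : IsCompact ((K : Set (EuclideanSpace ℝ (Fin n))) + -(K : Set _)) :=
    K.isCompact.add K.isCompact.neg
  obtain ⟨x, hx⟩ := hK
  have h0 : (K : Set (EuclideanSpace ℝ (Fin n))) + -(K : Set _) ∈ nhds 0 := by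
    refine Filter.mem_of_superset
      ((isOpen_interior.add_right (t := -(K : Set _))).mem_nhds ?_)
      (Set.add_subset_add_right interior_subset)
    exact ⟨x, hx, -x, by simpa using interior_subset hx, by simp⟩
  rw [diffNorm, gauge_le_one_iff_mem_closure (K.convex.add K.convex.neg) h0,
    hcomp.isClosed.closure_eq, ← sub_eq_add_neg, Set.mem_sub]
  rfl

theorem exists_widthInDirection_eq {n : ℕ} (K : ConvexBody (EuclideanSpace ℝ (Fin n)))
    (φ : EuclideanSpace ℝ (Fin n) →L[ℝ] ℝ) :
    ∃ a ∈ K, ∃ b ∈ K, widthInDirection K φ = φ a - φ b ∧ ∀ x ∈ K, φ b ≤ φ x ∧ φ x ≤ φ a := by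
  obtain ⟨a, ha, hmax⟩ := K.isCompact.exists_isMaxOn K.nonempty φ.continuous.continuousOn
  obtain ⟨b, hb, hmin⟩ := K.isCompact.exists_isMinOn K.nonempty φ.continuous.continuousOn
  refine ⟨a, ha, b, hb, ?_, fun x hx => ⟨hmin hx, hmax hx⟩⟩
  have h1 : IsGreatest (φ '' (K : Set _)) (φ a) :=
    ⟨⟨a, ha, rfl⟩, Set.forall_mem_image.2 fun x hx => hmax hx⟩
  have h2 : IsLeast (φ '' (K : Set _)) (φ b) :=
    ⟨⟨b, hb, rfl⟩, Set.forall_mem_image.2 fun x hx => hmin hx⟩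
  rw [widthInDirection, h1.csSup_eq, h2.csInf_eq]

theorem dualDiffNorm_eq_widthInDirection {n : ℕ} (K : ConvexBody (EuclideanSpace ℝ (Fin n)))
    (hK : (interior (K : Set (EuclideanSpace ℝ (Fin n)))).Nonempty)
    (φ : EuclideanSpace ℝ (Fin n) →L[ℝ] ℝ) : dualDiffNorm K φ = widthInDirection K φ := by
  obtain ⟨a, ha, b, hb, hw, hext⟩ := exists_widthInDirection_eq K φ
  have h : IsGreatest ((fun v => |φ v|) '' {v | diffNorm K v ≤ 1}) (φ a - φ b) := by
    refine ⟨⟨a - b, (diffNorm_le_one_iff K hK _).2 ⟨a, ha, b, hb, rfl⟩, ?_⟩, ?_⟩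
    · simp only [map_sub]
      exact abs_of_nonneg (sub_nonneg.2 (hext a ha).1)
    · rintro _ ⟨v, hv, rfl⟩
      obtain ⟨x, hx, y, hy, rfl⟩ := (diffNorm_le_one_iff K hK v).1 hv
      simp only [map_sub]
      rw [abs_le]
      constructor <;> linarith [hext x hx, hext y hy]
  rw [dualDiffNorm, h.csSup_eq, hw]

theorem continuous_widthInDirection {n : ℕ} (K : ConvexBody (EuclideanSpace ℝ (Fin n))) :
    Continuous (widthInDirection K) := by
  let ev : (EuclideanSpace ℝ (Fin n) →L[ℝ] ℝ) → EuclideanSpace ℝ (Fin n) → ℝ := fun φ x => φ x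
  have h : Continuous ↿ev := by
    change Continuous fun p : (EuclideanSpace ℝ (Fin n) →L[ℝ] ℝ) × EuclideanSpace ℝ (Fin n) =>
      p.1 p.2
    fun_prop
  exact (K.isCompact.continuous_sSup h).sub (K.isCompact.continuous_sInf h)

theorem theorem5p3 (n : ℕ) (K : ConvexBody (EuclideanSpace ℝ (Fin n)))
    (hK : (interior (K : Set (EuclideanSpace ℝ (Fin n)))).Nonempty)
    (F : EuclideanSpace ℝ (Fin n) → ℝ)
    (hF : ContDiffOn ℝ 1 F (K : Set (EuclideanSpace ℝ (Fin n)))) :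
    (∃ M m d : ℝ,
      IsGreatest (F '' (K : Set (EuclideanSpace ℝ (Fin n)))) M ∧
      IsLeast (F '' (K : Set (EuclideanSpace ℝ (Fin n)))) m ∧
      IsLeast ((fun x => dualDiffNorm K
        (fderivWithin ℝ F (K : Set (EuclideanSpace ℝ (Fin n))) x)) ''
          (K : Set (EuclideanSpace ℝ (Fin n)))) d ∧
      M - m ≥ d) ∧
    (∀ φ : EuclideanSpace ℝ (Fin n) →L[ℝ] ℝ, dualDiffNorm K φ = widthInDirection K φ) ∧
    (∃ M m w : ℝ,
      IsGreatest (F '' (K : Set (EuclideanSpace ℝ (Fin n)))) M ∧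
      IsLeast (F '' (K : Set (EuclideanSpace ℝ (Fin n)))) m ∧
      IsLeast ((fun x => widthInDirection K
        (fderivWithin ℝ F (K : Set (EuclideanSpace ℝ (Fin n))) x)) ''
          (K : Set (EuclideanSpace ℝ (Fin n)))) w ∧
      M - m ≥ w) := by
  have huniq : UniqueDiffOn ℝ (K : Set (EuclideanSpace ℝ (Fin n))) :=
    uniqueDiffOn_convex K.convex hK
  have hderiv : ∀ x ∈ (K : Set (EuclideanSpace ℝ (Fin n))),
      HasFDerivWithinAt F (fderivWithin ℝ F K x) K x := fun x hx =>
    ((hF.differentiableOn one_ne_zero) x hx).hasFDerivWithinAt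
  have hcont : ContinuousOn (fderivWithin ℝ F K) (K : Set (EuclideanSpace ℝ (Fin n))) :=
    hF.continuousOn_fderivWithin huniq le_rfl
  obtain ⟨y, hy, hmax⟩ := K.isCompact.exists_isMaxOn K.nonempty hF.continuousOn
  obtain ⟨x, hx, hmin⟩ := K.isCompact.exists_isMinOn K.nonempty hF.continuousOn
  obtain ⟨z, hz, hzmin⟩ := K.isCompact.exists_isMinOn K.nonempty
    ((continuous_widthInDirection K).comp_continuousOn hcont)
  have hM : IsGreatest (F '' (K : Set (EuclideanSpace ℝ (Fin n)))) (F y) :=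
    ⟨⟨y, hy, rfl⟩, Set.forall_mem_image.2 fun _ h => hmax h⟩
  have hm : IsLeast (F '' (K : Set (EuclideanSpace ℝ (Fin n)))) (F x) :=
    ⟨⟨x, hx, rfl⟩, Set.forall_mem_image.2 fun _ h => hmin h⟩
  have hw : IsLeast ((fun x => widthInDirection K
      (fderivWithin ℝ F (K : Set (EuclideanSpace ℝ (Fin n))) x)) ''
        (K : Set (EuclideanSpace ℝ (Fin n)))) (widthInDirection K (fderivWithin ℝ F K z)) :=
    ⟨⟨z, hz, rfl⟩, Set.forall_mem_image.2 fun _ h => hzmin h⟩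
  have hge : F y - F x ≥ widthInDirection K (fderivWithin ℝ F K z) := by
    refine le_of_forall_pos_le_add fun η hη => ?_
    obtain ⟨p, hp, q, hq, hpq⟩ := exists_sub_ge_of_forall_exists_sub_ge K.isCompact K.convex
      K.nonempty hderiv hcont (d := widthInDirection K (fderivWithin ℝ F K z)) (fun u hu => by
        obtain ⟨a, ha, b, hb, hab, -⟩ := exists_widthInDirection_eq K (fderivWithin ℝ F K u)
        exact ⟨a, ha, b, hb, hab ▸ hzmin hu⟩) hη
    have h1 : F q ≤ F y := hmax hq
    have h2 : F x ≤ F p := hmin hp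
    linarith
  have hdual := dualDiffNorm_eq_widthInDirection K hK
  refine ⟨⟨_, _, _, hM, hm, ?_, hge⟩, hdual, _, _, _, hM, hm, hw, hge⟩
  simpa only [hdual] using hw
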